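/- Let $X$ be an order unit space with order unit $e$: a real vector space partially ordered by a proper convex cone $X^+$, with an element $e\in X^+$ such that for every $x\in X$ there is $\lambda>0$ with $-\lambda e\le x\le\lambda e$, such that $\|x\|_e:=\inf\{\lambda>0 : -\lambda e\le x\le\lambda e\}$ is a norm on $X$, $X$ is complete in this norm, and $X^+$ is closed. Let $\|\cdot\|_e$ also denote the dual norm on $X^*$, and let $X^{*+}=\{\varphi\in X^* : \langle\varphi,x\rangle\ge 0 \text{ for all } x\in X^+\}$. Let $(\mathcal T(t))_{t\ge0}$ be a $C_0$ semigroup of bounded operators on $X$ which is positive, i.e. $\mathcal T(t)X^+\subseteq X^+$ for all $t\ge 0$. Let $\mathcal A$ be its generator, $\mathcal A x=\lim_{t\to0+}\frac1t(\mathcal T(t)x-x)$, with domain $\mathcal D_{\mathcal A}$ the set of all $x$ for which the limit exists. Let $z\in X^+$ be an $L^1$ $\|\cdot\|_e$-detector, i.e. for every $\varphi\in X^{*+}$, $$\int_0^\infty\langle\varphi,\mathcal T(t)z\rangle\,dt<\infty\ \Longrightarrow\ \int_0^\infty\|\mathcal T^*(t)\varphi\|_e\,dt<\infty .$$ Then the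 following conditions are equivalent: (i) the equation $\mathcal A x=-z$ has a positive solution $x\in\mathcal D_{\mathcal A}\cap X^+$; (ii) $\mathcal T(t)$ is weakly $L^1$ stable on $X^+$, i.e. $\int_0^\infty\langle\varphi,\mathcal T(t)x\rangle\,dt<\infty$ for all $\varphi\in X^{*+}$ and $x\in X^+$; (iii) $\mathcal T(t)$ is exponentially stable, i.e. there are $M,\varepsilon>0$ with $\|\mathcal T(t)\|\le Me^{-\varepsilon t}$ for all $t\ge0$; (iv) $\mathcal A$ has a bounded inverse $\mathcal A^{-1}$ defined on all of $X$, and $-\mathcal A^{-1}\ge0$, i.e. $-\mathcal A^{-1}X^+\subseteq X^+$. -/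

import Mathlib

open Filter Topology MeasureTheory Set

namespace PositiveSemigroup

section Order

variable {X : Type*} [NormedAddCommGroup X] [NormedSpace ℝ X] [PartialOrder X]

/-- `e` is an order unit: `e ≥ 0` and every `x` lies in some order interval `[-l e, l e]`. -/
def IsOrderUnit (e : X) : Prop :=
  0 ≤ e ∧ ∀ x : X, ∃ l : ℝ, 0 < l ∧ -(l • e) ≤ x ∧ x ≤ l • e

/-- The order unit norm `‖x‖_e = inf {l > 0 | -l e ≤ x ≤ l e}`. -/
noncomputable def orderUnitNorm (e x : X) : ℝ :=
  sInf {l : ℝ | 0 < l ∧ -(l • e) ≤ x ∧ x ≤ l • e}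

/-- The ordered normed space `X` is an order unit space with order unit `e`: the norm of `X` is
the order unit norm of `e`, `X` is complete in it, and the positive cone is closed. -/
structure IsOrderUnitSpace (e : X) : Prop where
  isOrderUnit : IsOrderUnit e
  norm_eq : ∀ x : X, ‖x‖ = orderUnitNorm e x
  complete : CompleteSpace X
  isClosed_cone : IsClosed {x : X | 0 ≤ x}

/-- Membership in the dual cone: `φ ≥ 0` on the positive cone. -/
def IsPositiveFunctional (φ : X →L[ℝ] ℝ) : Prop :=
  ∀ x : X, 0 ≤ x → 0 ≤ φ x

end Order

section Semigroup

variable {X : Type*} [NormedAddCommGroup X] [NormedSpace ℝ X]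

/-- `(T t)_{t ≥ 0}` is a `C₀` semigroup of bounded operators; values at `t < 0` are irrelevant. -/
structure IsC0Semigroup (T : ℝ → X →L[ℝ] X) : Prop where
  map_zero : T 0 = ContinuousLinearMap.id ℝ X
  map_add : ∀ s t : ℝ, 0 ≤ s → 0 ≤ t → T (s + t) = (T s).comp (T t)
  continuousOn : ∀ x : X, ContinuousOn (fun t => T t x) (Ici 0)

/-- `y = lim_{t → 0+} (T t x - x) / t`. -/
def HasGeneratorValue (T : ℝ → X →L[ℝ] X) (x y : X) : Prop :=
  Tendsto (fun t : ℝ => t⁻¹ • (T t x - x)) (𝓝[>] 0) (𝓝 y)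

theorem HasGeneratorValue.unique {T : ℝ → X →L[ℝ] X} {x y y' : X}
    (h : HasGeneratorValue T x y) (h' : HasGeneratorValue T x y') : y = y' :=
  tendsto_nhds_unique h h'

theorem HasGeneratorValue.zero (T : ℝ → X →L[ℝ] X) : HasGeneratorValue T 0 0 := by
  simp [HasGeneratorValue]

theorem HasGeneratorValue.add {T : ℝ → X →L[ℝ] X} {x y x' y' : X}
    (h : HasGeneratorValue T x y) (h' : HasGeneratorValue T x' y') :
    HasGeneratorValue T (x + x') (y + y') := by
  refine (Tendsto.add h h').congr fun t => ?_
  rw [← smul_add, (T t).map_add]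
  congr 1
  abel

theorem HasGeneratorValue.smul {T : ℝ → X →L[ℝ] X} {x y : X} (c : ℝ)
    (h : HasGeneratorValue T x y) : HasGeneratorValue T (c • x) (c • y) := by
  refine (Tendsto.const_smul h c).congr fun t => ?_
  rw [smul_comm, (T t).map_smul, smul_sub]

/-- The infinitesimal generator `A x = lim_{t → 0+} (T t x - x) / t`, as an unbounded operator
whose domain consists of all `x` for which the limit exists in norm. -/
noncomputable def generator (T : ℝ → X →L[ℝ] X) : X →ₗ.[ℝ] X where
  domain :=
    { carrier := {x | ∃ y, HasGeneratorValue T x y}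
      zero_mem' := ⟨0, HasGeneratorValue.zero T⟩
      add_mem' := fun ⟨y, h⟩ ⟨y', h'⟩ => ⟨y + y', h.add h'⟩
      smul_mem' := fun c _ ⟨y, h⟩ => ⟨c • y, h.smul c⟩ }
  toFun :=
    { toFun := fun x => Classical.choose x.2
      map_add' := fun x x' => (Classical.choose_spec (x + x').2).unique
        ((Classical.choose_spec x.2).add (Classical.choose_spec x'.2))
      map_smul' := fun c x => (Classical.choose_spec (c • x).2).unique
        ((Classical.choose_spec x.2).smul c) }

theorem hasGeneratorValue_generator (T : ℝ → X →L[ℝ] X) (x : (generator T).domain) :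
    HasGeneratorValue T (x : X) (generator T x) :=
  Classical.choose_spec x.2

/-- Exponential stability: `‖T t‖ ≤ M exp (-ε t)` for all `t ≥ 0`, with some `M, ε > 0`. -/
def ExponentiallyStable (T : ℝ → X →L[ℝ] X) : Prop :=
  ∃ M ε : ℝ, 0 < M ∧ 0 < ε ∧ ∀ t : ℝ, 0 ≤ t → ‖T t‖ ≤ M * Real.exp (-(ε * t))

/-- The bounded operator `R` on `X` is the inverse of the unbounded operator `A`. -/
def IsBoundedInverse (A : X →ₗ.[ℝ] X) (R : X →L[ℝ] X) : Prop :=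
  (∀ y : X, ∃ h : R y ∈ A.domain, A ⟨R y, h⟩ = y) ∧ ∀ x : A.domain, R (A x) = (x : X)

end Semigroup

section PositiveSemigroup

variable {X : Type*} [NormedAddCommGroup X] [NormedSpace ℝ X] [PartialOrder X]

/-- Each `T t`, `t ≥ 0`, maps the positive cone into itself. -/
def IsPositiveSemigroup (T : ℝ → X →L[ℝ] X) : Prop :=
  ∀ t : ℝ, 0 ≤ t → ∀ x : X, 0 ≤ x → 0 ≤ T t x

/-- Weak `L¹` stability on the positive cone: `∫₀^∞ ⟨φ, T t x⟩ dt < ∞` for all `φ, x ≥ 0`. -/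
def WeaklyL1StableOnCone (T : ℝ → X →L[ℝ] X) : Prop :=
  ∀ φ : X →L[ℝ] ℝ, IsPositiveFunctional φ → ∀ x : X, 0 ≤ x →
    ∫⁻ t in Ici (0 : ℝ), ENNReal.ofReal (φ (T t x)) < ⊤

/-- `z ≥ 0` is an `L¹` norm-detector: for each `φ ≥ 0` in the dual, `∫₀^∞ ⟨φ, T t z⟩ dt < ∞` implies
`∫₀^∞ ‖T*(t) φ‖ dt < ∞`, where `T*(t) φ = φ ∘ T t` and the norm is the dual norm. -/
def IsL1NormDetector (T : ℝ → X →L[ℝ] X) (z : X) : Prop :=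
  0 ≤ z ∧ ∀ φ : X →L[ℝ] ℝ, IsPositiveFunctional φ →
    ∫⁻ t in Ici (0 : ℝ), ENNReal.ofReal (φ (T t z)) < ⊤ →
      ∫⁻ t in Ici (0 : ℝ), ENNReal.ofReal ‖φ.comp (T t)‖ < ⊤

end PositiveSemigroup

end PositiveSemigroup

/-! The cycle (i) → (ii) → (iii) → (iv) → (i) is proved. If `A x = -z` with `x ≥ 0`, integrating
along the orbit gives `∫₀ᵗ φ(T s z) ds = φ x - φ(T t x) ≤ φ x`; the detector property upgrades this
to integrability of `‖φ ∘ T t‖`, hence to weak `L¹` stability.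

The core is (ii) → (iii), a Datko-type argument. In an order unit space, positive operators and
functionals are controlled by their values at `e`, so only the orbit of `e` matters. A gliding-hump
argument on the dual cone (`exists_le_mul_apply_orderUnit`) turns finiteness of `∫ φ(T t e) dt` for
each `φ` into a bound `C φ(e)`. Comparing `T t e = T s (T (t - s) e)` with `K T s e` and averaging
over `s` (`mul_apply_le_integral`) yields first boundedness, then `T t e ≤ (L C / t) e`. Hence `‖T
t₀‖ ≤ 1/2` for some `t₀`, and the semigroup law gives exponential decay.

Finally `-∫₀^∞ T t dt` inverts `A`, and its negative preserves the cone; applying the inverse to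
`-z` solves (i). -/

namespace PositiveSemigroup

/-! ### Order unit norm, positive operators and functionals -/

section OrderUnit

variable {X : Type*} [NormedAddCommGroup X] [NormedSpace ℝ X] [PartialOrder X]
  [IsOrderedAddMonoid X]

theorem IsOrderUnitSpace.orderClosedTopology {e : X} (hX : IsOrderUnitSpace e) :
    OrderClosedTopology X := by
  refine ⟨?_⟩
  have h := hX.isClosed_cone.preimage (continuous_snd.sub continuous_fst : Continuous
    fun p : X × X => p.2 - p.1)
  simpa [preimage, sub_nonneg] using h

theorem IsPositiveFunctional.mono {φ : X →L[ℝ] ℝ} (hφ : IsPositiveFunctional φ) {x y : X}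
    (h : x ≤ y) : φ x ≤ φ y := by
  have := hφ _ (sub_nonneg.2 h)
  rwa [map_sub, sub_nonneg] at this

variable [IsOrderedModule ℝ X]

theorem IsOrderUnitSpace.neg_le_and_le_of_norm_lt {e : X} (hX : IsOrderUnitSpace e) {x : X}
    {c : ℝ} (hc : ‖x‖ < c) : -(c • e) ≤ x ∧ x ≤ c • e := by
  rw [hX.norm_eq, orderUnitNorm] at hc
  obtain ⟨l₀, hl₀⟩ := hX.isOrderUnit.2 x
  obtain ⟨l, ⟨-, h₁, h₂⟩, hlc⟩ := exists_lt_of_csInf_lt ⟨l₀, hl₀⟩ hc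
  have hle : l • e ≤ c • e := smul_le_smul_of_nonneg_right hlc.le hX.isOrderUnit.1
  exact ⟨(neg_le_neg hle).trans h₁, h₂.trans hle⟩

/-- Closedness of the cone lets `c` decrease to `‖x‖`, so the infimum defining the norm satisfies
the inequalities itself. -/
theorem IsOrderUnitSpace.neg_le_and_le {e : X} (hX : IsOrderUnitSpace e) (x : X) :
    -(‖x‖ • e) ≤ x ∧ x ≤ ‖x‖ • e := by
  have := hX.orderClosedTopology
  have hlim : Tendsto (fun c : ℝ => c • e) (𝓝[>] ‖x‖) (𝓝 (‖x‖ • e)) :=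
    (tendsto_id.smul_const e).mono_left nhdsWithin_le_nhds
  refine ⟨le_of_tendsto hlim.neg ?_, ge_of_tendsto hlim ?_⟩
  · filter_upwards [self_mem_nhdsWithin] with c hc using (hX.neg_le_and_le_of_norm_lt hc).1
  · filter_upwards [self_mem_nhdsWithin] with c hc using (hX.neg_le_and_le_of_norm_lt hc).2

theorem IsOrderUnitSpace.norm_le {e : X} (hX : IsOrderUnitSpace e) {x : X} {c : ℝ}
    (hc : 0 ≤ c) (h₁ : -(c • e) ≤ x) (h₂ : x ≤ c • e) : ‖x‖ ≤ c := by
  refine le_of_forall_gt_imp_ge_of_dense fun d hd => ?_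
  have hle : c • e ≤ d • e := smul_le_smul_of_nonneg_right hd.le hX.isOrderUnit.1
  rw [hX.norm_eq, orderUnitNorm]
  exact csInf_le ⟨0, fun l hl => hl.1.le⟩
    ⟨hc.trans_lt hd, (neg_le_neg hle).trans h₁, h₂.trans hle⟩

/-- The norm of a positive operator is controlled by its value at the order unit. -/
theorem IsOrderUnitSpace.opNorm_le {e : X} (hX : IsOrderUnitSpace e) {S : X →L[ℝ] X}
    (hS : ∀ x, 0 ≤ x → 0 ≤ S x) {c : ℝ} (hc : 0 ≤ c) (h : S e ≤ c • e) : ‖S‖ ≤ c := by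
  refine S.opNorm_le_bound hc fun x => ?_
  obtain ⟨h₁, h₂⟩ := hX.neg_le_and_le x
  have hle : ‖x‖ • S e ≤ (c * ‖x‖) • e := by
    rw [mul_comm, mul_smul]
    exact smul_le_smul_of_nonneg_left h (norm_nonneg x)
  have h₃ := hS _ (sub_nonneg.2 h₁)
  have h₄ := hS _ (sub_nonneg.2 h₂)
  simp only [map_sub, map_neg, map_smul, sub_nonneg] at h₃ h₄
  exact hX.norm_le (by positivity) ((neg_le_neg hle).trans h₃) (h₄.trans hle)

theorem IsPositiveFunctional.norm_le {e : X} (hX : IsOrderUnitSpace e) {φ : X →L[ℝ] ℝ}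
    (hφ : IsPositiveFunctional φ) : ‖φ‖ ≤ φ e := by
  refine φ.opNorm_le_bound (hφ e hX.isOrderUnit.1) fun x => ?_
  obtain ⟨h₁, h₂⟩ := hX.neg_le_and_le x
  have h₃ := hφ.mono h₁
  have h₄ := hφ.mono h₂
  simp only [map_neg, map_smul, smul_eq_mul] at h₃ h₄
  rw [Real.norm_eq_abs, abs_le]
  constructor <;> linarith

/-- Positive functionals determine the order. -/
theorem IsOrderUnitSpace.le_of_forall_functional {e : X} (hX : IsOrderUnitSpace e) {x y : X}
    (h : ∀ φ : X →L[ℝ] ℝ, IsPositiveFunctional φ → φ x ≤ φ y) : x ≤ y := by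
  by_contra hxy
  have hconv : Convex ℝ {x : X | 0 ≤ x} := convex_Ici 0
  obtain ⟨f, u, hfu, hu⟩ := geometric_hahn_banach_point_closed hconv hX.isClosed_cone
    (x := y - x) (by simpa [sub_nonneg] using hxy)
  have hu₀ : u < 0 := by simpa using hu 0 le_rfl
  have hf : IsPositiveFunctional f := by
    intro w hw
    by_contra! hneg
    -- The cone contains this positive multiple of `w`, on which `f` equals `u`, while `f > u` on
    -- the cone.
    have := hu ((u * (f w)⁻¹) • w) (smul_nonneg (mul_pos_of_neg_of_neg hu₀ (inv_neg''.2 hneg)).le hw)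
    simp [hneg.ne] at this
  have := h f hf
  rw [map_sub] at hfu
  linarith

end OrderUnit

/-! ### Gliding hump on the dual cone -/

section UniformBound

variable {X : Type*} [NormedAddCommGroup X] [NormedSpace ℝ X] [PartialOrder X]
  [IsOrderedAddMonoid X] [IsOrderedModule ℝ X]

/-- A uniform boundedness principle on the dual cone: a monotone, positively homogeneous function
on the dual cone of an order unit space is dominated by evaluation at the order unit. -/
theorem exists_le_mul_apply_orderUnit {e : X} (hX : IsOrderUnitSpace e)
    (J : (X →L[ℝ] ℝ) → ℝ)
    (hmono : ∀ φ ψ, IsPositiveFunctional φ → IsPositiveFunctional ψ →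
      (∀ x, 0 ≤ x → φ x ≤ ψ x) → J φ ≤ J ψ)
    (hsmul : ∀ (c : ℝ) φ, 0 ≤ c → IsPositiveFunctional φ → J (c • φ) = c * J φ) :
    ∃ C : ℝ, 0 ≤ C ∧ ∀ φ, IsPositiveFunctional φ → J φ ≤ C * φ e := by
  by_contra! hcon
  -- The growth `4 ^ n` survives normalisation to `g n e = 2⁻ⁿ`: the `g n` are summable, yet `J (g
  -- n) > 2 ^ n`. Their sum dominates every `g n`, so `J` of the sum could not be finite.
  choose f hf hJf using fun n : ℕ => hcon (4 ^ n) (by positivity)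
  have hfe : ∀ n, 0 < f n e := by
    intro n
    -- If `f n e = 0` then `f n = 0`, and homogeneity gives `J 0 = 0`, against the strict
    -- inequality.
    refine (hf n e hX.isOrderUnit.1).lt_of_ne fun h => ?_
    have hzero : f n = 0 := by
      have := (hf n).norm_le hX
      rw [← h] at this
      exact norm_le_zero_iff.1 this
    have hJ := hsmul 0 (f n) le_rfl (hf n)
    rw [zero_smul, zero_mul, ← hzero] at hJ
    have := hJf n
    rw [hJ, ← h, mul_zero] at this
    exact lt_irrefl _ this
  set g : ℕ → X →L[ℝ] ℝ := fun n => ((2 ^ n * f n e)⁻¹ : ℝ) • f n with hg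
  have hc : ∀ n, (0 : ℝ) ≤ (2 ^ n * f n e)⁻¹ := fun n => by have := hfe n; positivity
  have hgpos : ∀ n, IsPositiveFunctional (g n) := fun n x hx =>
    mul_nonneg (hc n) (hf n x hx)
  have hge : ∀ n, g n e = (1 / 2) ^ n := by
    intro n
    have := (hfe n).ne'
    simp only [hg, smul_apply, smul_eq_mul]
    rw [one_div, inv_pow]
    field_simp
  have hJg : ∀ n, (2 : ℝ) ^ n < J (g n) := by
    intro n
    have := hfe n
    rw [hg, hsmul _ _ (hc n) (hf n), ← div_eq_inv_mul, lt_div_iff₀ (by positivity)]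
    calc (2 : ℝ) ^ n * (2 ^ n * f n e) = 4 ^ n * f n e := by
          rw [← mul_assoc, ← mul_pow]; norm_num
      _ < J (f n) := hJf n
  have hsum : Summable g := Summable.of_norm_bounded summable_geometric_two fun n =>
    ((hgpos n).norm_le hX).trans (hge n).le
  have happ : ∀ x, HasSum (fun n => g n x) ((∑' n, g n) x) := fun x =>
    hsum.hasSum.mapL (ContinuousLinearMap.apply ℝ ℝ x)
  have hpos : IsPositiveFunctional (∑' n, g n) := fun x hx =>
    (happ x).nonneg fun n => hgpos n x hx
  have hbound : ∀ n, (2 : ℝ) ^ n ≤ J (∑' n, g n) := fun n =>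
    (hJg n).le.trans (hmono _ _ (hgpos n) hpos fun x hx =>
      le_hasSum (happ x) n fun m _ => hgpos m x hx)
  obtain ⟨n, hn⟩ := pow_unbounded_of_one_lt (J (∑' n, g n)) (one_lt_two : (1 : ℝ) < 2)
  exact (hbound n).not_gt hn

end UniformBound

/-! ### Differentiating orbits; exponential decay from one contraction -/

section Orbits

variable {X : Type*} [NormedAddCommGroup X] [NormedSpace ℝ X] {T : ℝ → X →L[ℝ] X}

theorem IsC0Semigroup.add_apply (hT : IsC0Semigroup T) {s t : ℝ} (hs : 0 ≤ s) (ht : 0 ≤ t)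
    (x : X) : T (s + t) x = T s (T t x) := by
  rw [hT.map_add s t hs ht]; rfl

theorem IsC0Semigroup.continuousOn_functional (hT : IsC0Semigroup T) (φ : X →L[ℝ] ℝ) (x : X) :
    ContinuousOn (fun t => φ (T t x)) (Ici 0) :=
  φ.continuous.comp_continuousOn (hT.continuousOn x)

theorem IsC0Semigroup.intervalIntegrable_functional (hT : IsC0Semigroup T) (φ : X →L[ℝ] ℝ)
    (x : X) {a b : ℝ} (ha : 0 ≤ a) (hab : a ≤ b) :
    IntervalIntegrable (fun t => φ (T t x)) volume a b := by
  refine ((hT.continuousOn_functional φ x).mono ?_).intervalIntegrable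
  rw [uIcc_of_le hab]
  exact fun t ht => ha.trans ht.1

/-- Right differentiability of orbits that start in the domain of the generator. -/
theorem IsC0Semigroup.hasDerivWithinAt_orbit (hT : IsC0Semigroup T) {x y : X}
    (hxy : HasGeneratorValue T x y) {s : ℝ} (hs : 0 ≤ s) :
    HasDerivWithinAt (fun t => T t x) (T s y) (Ioi s) s := by
  rw [hasDerivWithinAt_iff_tendsto_slope' self_notMem_Ioi]
  have hshift : Tendsto (fun u : ℝ => u - s) (𝓝[>] s) (𝓝[>] 0) := by
    refine tendsto_nhdsWithin_iff.2 ⟨?_, ?_⟩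
    · have : Tendsto (fun u : ℝ => u - s) (𝓝 s) (𝓝 (s - s)) := tendsto_id.sub_const s
      rw [sub_self] at this
      exact this.mono_left nhdsWithin_le_nhds
    · filter_upwards [self_mem_nhdsWithin] with u hu
      exact sub_pos.2 (mem_Ioi.1 hu)
  refine (((T s).continuous.tendsto y).comp (hxy.comp hshift)).congr' ?_
  filter_upwards [self_mem_nhdsWithin] with u hu
  have hu' : 0 ≤ u - s := (sub_pos.2 (mem_Ioi.1 hu)).le
  simp only [Function.comp_apply, map_smul, map_sub, slope_def_module]
  rw [← hT.add_apply hs hu', add_sub_cancel]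

theorem IsC0Semigroup.integral_functional_generatorValue (hT : IsC0Semigroup T) {x y : X}
    (hxy : HasGeneratorValue T x y) (φ : X →L[ℝ] ℝ) {t : ℝ} (ht : 0 ≤ t) :
    ∫ s in (0 : ℝ)..t, φ (T s y) = φ (T t x) - φ x := by
  have h := intervalIntegral.integral_eq_sub_of_hasDeriv_right (a := 0) (b := t)
    (f := fun s => φ (T s x)) (f' := fun s => φ (T s y))
    ((hT.continuousOn_functional φ x).mono ?_) ?_
    (hT.intervalIntegrable_functional φ y le_rfl ht)
  · rw [h, hT.map_zero]; rfl
  · rw [uIcc_of_le ht]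
    exact fun s hs => hs.1
  · intro s hs
    rw [min_eq_left ht] at hs
    exact φ.hasFDerivAt.comp_hasDerivWithinAt s (hT.hasDerivWithinAt_orbit hxy hs.1.le)

/-- Powers of one contraction together with a global bound give exponential decay. -/
theorem IsC0Semigroup.exponentiallyStable_of_norm_le_half (hT : IsC0Semigroup T) {K t₀ : ℝ}
    (hK : ∀ t, 0 ≤ t → ‖T t‖ ≤ K) (ht₀ : 0 < t₀) (hhalf : ‖T t₀‖ ≤ 1 / 2) :
    ExponentiallyStable T := by
  have hK₀ : 0 ≤ K := (norm_nonneg _).trans (hK 0 le_rfl)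
  have hpow : ∀ (n : ℕ) (r : ℝ), 0 ≤ r → ‖T (n * t₀ + r)‖ ≤ (1 / 2) ^ n * K := by
    intro n
    induction n with
    | zero => intro r hr; simpa using hK r hr
    | succ n ih =>
      intro r hr
      have hsplit : ((n + 1 : ℕ) : ℝ) * t₀ + r = t₀ + (n * t₀ + r) := by push_cast; ring
      rw [hsplit, hT.map_add _ _ ht₀.le (by positivity)]
      calc ‖(T t₀).comp (T (n * t₀ + r))‖ ≤ ‖T t₀‖ * ‖T (n * t₀ + r)‖ :=
            ContinuousLinearMap.opNorm_comp_le _ _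
        _ ≤ 1 / 2 * ((1 / 2) ^ n * K) := by gcongr; exact ih r hr
        _ = (1 / 2) ^ (n + 1) * K := by ring
  -- The factor 2 pays for rounding `t / t₀` down to `n`; `K + 1` keeps the constant positive.
  refine ⟨2 * (K + 1), Real.log 2 / t₀, by positivity,
    div_pos (Real.log_pos one_lt_two) ht₀, fun t ht => ?_⟩
  set n := ⌊t / t₀⌋₊
  have hn₁ : (n : ℝ) * t₀ ≤ t := (le_div_iff₀ ht₀).1 (Nat.floor_le (by positivity))
  have hn₂ : t / t₀ < n + 1 := Nat.lt_floor_add_one _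
  have hnorm := hpow n (t - n * t₀) (sub_nonneg.2 hn₁)
  rw [add_sub_cancel] at hnorm
  have hexp : ((1 : ℝ) / 2) ^ n ≤ 2 * Real.exp (-(Real.log 2 / t₀ * t)) := by
    have h₂ : (2 : ℝ) = Real.exp (Real.log 2) := (Real.exp_log two_pos).symm
    have h₁ : ((1 : ℝ) / 2) ^ n = Real.exp (-(n * Real.log 2)) := by
      rw [Real.exp_neg, Real.exp_nat_mul, Real.exp_log two_pos, one_div, inv_pow]
    rw [h₁]
    nth_rw 2 [h₂]
    rw [← Real.exp_add, Real.exp_le_exp]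
    have : Real.log 2 / t₀ * t = t / t₀ * Real.log 2 := by ring
    rw [this]
    nlinarith [Real.log_pos one_lt_two]
  calc ‖T t‖ ≤ (1 / 2) ^ n * K := hnorm
    _ ≤ (2 * Real.exp (-(Real.log 2 / t₀ * t))) * (K + 1) := by gcongr; linarith
    _ = 2 * (K + 1) * Real.exp (-(Real.log 2 / t₀ * t)) := by ring

end Orbits

/-! ### Inverting the generator by the integral of the semigroup -/

section Resolvent

variable {X : Type*} [NormedAddCommGroup X] [NormedSpace ℝ X] {T : ℝ → X →L[ℝ] X}

theorem IsC0Semigroup.integrableOn_orbit (hT : IsC0Semigroup T) {M ε : ℝ} (hε : 0 < ε)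
    (hM : ∀ t, 0 ≤ t → ‖T t‖ ≤ M * Real.exp (-(ε * t))) (x : X) :
    IntegrableOn (fun t => T t x) (Ioi 0) := by
  have hdom : IntegrableOn (fun t => M * Real.exp (-ε * t) * ‖x‖) (Ioi 0) :=
    ((exp_neg_integrableOn_Ioi 0 hε).const_mul M).mul_const ‖x‖
  refine Integrable.mono' hdom (((hT.continuousOn x).mono Ioi_subset_Ici_self).aestronglyMeasurable
    measurableSet_Ioi) ?_
  filter_upwards [ae_restrict_mem measurableSet_Ioi] with t ht
  have h := hM t (le_of_lt ht)
  rw [← neg_mul] at h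
  exact (T t).le_of_opNorm_le h x

theorem IsC0Semigroup.exists_integral_operator (hT : IsC0Semigroup T)
    (hs : ExponentiallyStable T) :
    ∃ Q : X →L[ℝ] X, ∀ x, Q x = ∫ t in Ioi (0 : ℝ), T t x := by
  obtain ⟨M, ε, -, hε, hM⟩ := hs
  have hint := hT.integrableOn_orbit hε hM
  refine ⟨LinearMap.mkContinuous
    { toFun := fun x => ∫ t in Ioi (0 : ℝ), T t x
      map_add' := fun x y => by simpa using integral_add (hint x) (hint y)
      map_smul' := fun c x => by simpa using integral_smul c fun t => T t x }
    (∫ t in Ioi (0 : ℝ), M * Real.exp (-ε * t)) fun x => ?_, fun x => rfl⟩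
  rw [← integral_mul_const]
  refine norm_integral_le_of_norm_le
    (((exp_neg_integrableOn_Ioi 0 hε).const_mul M).mul_const ‖x‖) ?_
  filter_upwards [ae_restrict_mem measurableSet_Ioi] with t ht
  have h := hM t (le_of_lt ht)
  rw [← neg_mul] at h
  exact (T t).le_of_opNorm_le h x

variable [CompleteSpace X]

/-- `T h` shifts the integral to `(h, ∞)`, so the difference quotient is `-h⁻¹ ∫₀ʰ T t x dt`, which
tends to `-x`. -/
theorem IsC0Semigroup.hasGeneratorValue_integral (hT : IsC0Semigroup T)
    (hs : ExponentiallyStable T) (x : X) :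
    HasGeneratorValue T (∫ t in Ioi (0 : ℝ), T t x) (-x) := by
  obtain ⟨M, ε, -, hε, hM⟩ := hs
  have hint := hT.integrableOn_orbit hε hM x
  have hcont : ContinuousWithinAt (fun t => T t x) (Ioi 0) 0 :=
    (hT.continuousOn x 0 self_mem_Ici).mono Ioi_subset_Ici_self
  have hderiv : HasDerivWithinAt (fun u => ∫ t in (0 : ℝ)..u, T t x) (T 0 x) (Ioi 0) 0 :=
    (intervalIntegral.integral_hasDerivWithinAt_right (s := Ici 0) (t := Ioi 0)
      IntervalIntegrable.refl
      (((hT.continuousOn x).mono Ioi_subset_Ici_self).stronglyMeasurableAtFilter_nhdsWithin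
        measurableSet_Ioi 0) hcont).mono Ioi_subset_Ici_self
  rw [hasDerivWithinAt_iff_tendsto_slope' self_notMem_Ioi, hT.map_zero] at hderiv
  refine hderiv.neg.congr' ?_
  filter_upwards [self_mem_nhdsWithin] with h hh
  have hh₀ : (0 : ℝ) ≤ h := le_of_lt hh
  have hshift : T h (∫ t in Ioi (0 : ℝ), T t x) = ∫ t in Ioi h, T t x := by
    rw [← (T h).integral_comp_comm hint,
      ← (measurePreserving_add_right volume h).setIntegral_preimage_emb
        (measurableEmbedding_addRight h) _ (Ioi h), preimage_add_const_Ioi, sub_self]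
    refine setIntegral_congr_fun measurableSet_Ioi fun t ht => ?_
    rw [← hT.add_apply hh₀ (le_of_lt ht), add_comm]
  have hsplit := intervalIntegral.integral_interval_add_Ioi hint
    (hint.mono_set (Ioi_subset_Ioi hh₀))
  rw [hshift, ← hsplit, slope_def_module, intervalIntegral.integral_same, sub_zero, sub_zero,
    ← smul_neg]
  congr 1
  abel

/-- An exponentially stable semigroup has an invertible generator, with inverse
`-∫₀^∞ T t dt`. -/
theorem IsC0Semigroup.isBoundedInverse_neg_integral (hT : IsC0Semigroup T)
    (hs : ExponentiallyStable T) {Q : X →L[ℝ] X} (hQ : ∀ x, Q x = ∫ t in Ioi (0 : ℝ), T t x) :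
    IsBoundedInverse (generator T) (-Q) := by
  have hval : ∀ x, HasGeneratorValue T (Q x) (-x) := fun x => by
    rw [hQ]; exact hT.hasGeneratorValue_integral hs x
  have hval' : ∀ x, HasGeneratorValue T ((-Q) x) x := fun x => by
    simpa using (hval x).smul (-1)
  refine ⟨fun y => ⟨⟨y, hval' y⟩, (hasGeneratorValue_generator T ⟨_, _⟩).unique (hval' y)⟩,
    fun x => ?_⟩
  obtain ⟨M, ε, -, hε, hM⟩ := hs
  have hcomm : ∀ t, 0 ≤ t → ∀ y, Q (T t y) = T t (Q y) := fun t ht y => by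
    rw [hQ, hQ, ← (T t).integral_comp_comm (hT.integrableOn_orbit hε hM y)]
    refine setIntegral_congr_fun measurableSet_Ioi fun s hs => ?_
    rw [← hT.add_apply ht (le_of_lt hs), ← hT.add_apply (le_of_lt hs) ht, add_comm]
  -- `Q` is bounded and commutes with `T t`, so it passes through the limit defining the generator.
  have hlim : HasGeneratorValue T (Q x) (Q (generator T x)) := by
    refine ((Q.continuous.tendsto _).comp (hasGeneratorValue_generator T x)).congr' ?_
    filter_upwards [self_mem_nhdsWithin] with t ht
    simp only [Function.comp_apply, map_smul, map_sub]
    rw [hcomm t (le_of_lt ht)]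
  simpa using (neg_eq_iff_eq_neg.2 (hlim.unique (hval x)))

end Resolvent

/-! ### From a positive solution to weak and exponential stability -/

section Stability

variable {X : Type*} [NormedAddCommGroup X] [NormedSpace ℝ X] [PartialOrder X]
  {T : ℝ → X →L[ℝ] X}

theorem IsC0Semigroup.integrableOn_functional_of_lintegral_lt_top (hT : IsC0Semigroup T)
    (hpos : IsPositiveSemigroup T) {φ : X →L[ℝ] ℝ} (hφ : IsPositiveFunctional φ) {x : X}
    (hx : 0 ≤ x) (h : ∫⁻ t in Ici (0 : ℝ), ENNReal.ofReal (φ (T t x)) < ⊤) :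
    IntegrableOn (fun t => φ (T t x)) (Ici 0) := by
  refine (lintegral_ofReal_ne_top_iff_integrable
    ((hT.continuousOn_functional φ x).aestronglyMeasurable measurableSet_Ici) ?_).1 h.ne
  filter_upwards [ae_restrict_mem measurableSet_Ici] with t ht using hφ _ (hpos t ht x hx)

/-- A positive solution of `A x = -z` bounds the integrals of the orbit of a positive `z`. -/
theorem IsC0Semigroup.lintegral_lt_top_of_generatorValue (hT : IsC0Semigroup T)
    (hpos : IsPositiveSemigroup T) {x z : X} (hx : 0 ≤ x) (hz : 0 ≤ z)
    (hxz : HasGeneratorValue T x (-z)) {φ : X →L[ℝ] ℝ} (hφ : IsPositiveFunctional φ) :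
    ∫⁻ t in Ici (0 : ℝ), ENNReal.ofReal (φ (T t z)) < ⊤ := by
  suffices h : IntegrableOn (fun t => φ (T t z)) (Ioi 0) from
    (integrableOn_Ici_iff_integrableOn_Ioi (by simp) |>.2 h).setLIntegral_lt_top
  refine integrableOn_Ioi_of_intervalIntegral_norm_bounded (φ x) 0 (fun t : ℝ => ?_)
    tendsto_id ?_
  · exact (((hT.continuousOn_functional φ z).mono Icc_subset_Ici_self).integrableOn_Icc).mono_set
      Ioc_subset_Icc_self
  · filter_upwards [eventually_ge_atTop 0] with t ht
    have hFTC := hT.integral_functional_generatorValue hxz φ ht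
    have hcongr : ∫ s in (0 : ℝ)..t, ‖φ (T s z)‖ = ∫ s in (0 : ℝ)..t, φ (T s z) := by
      refine intervalIntegral.integral_congr fun s hs => ?_
      rw [uIcc_of_le ht] at hs
      exact Real.norm_of_nonneg (hφ _ (hpos s hs.1 z hz))
    simp only [map_neg, intervalIntegral.integral_neg] at hFTC
    have := hφ _ (hpos t ht x hx)
    rw [id, hcongr]
    linarith

theorem weaklyL1StableOnCone_of_isL1NormDetector (hT : IsC0Semigroup T)
    (hpos : IsPositiveSemigroup T) {x z : X} (hx : 0 ≤ x) (hz : IsL1NormDetector T z)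
    (hxz : HasGeneratorValue T x (-z)) : WeaklyL1StableOnCone T := by
  intro φ hφ y hy
  have hfin := hz.2 φ hφ (hT.lintegral_lt_top_of_generatorValue hpos hx hz.1 hxz hφ)
  calc ∫⁻ t in Ici (0 : ℝ), ENNReal.ofReal (φ (T t y))
      ≤ ∫⁻ t in Ici (0 : ℝ), ENNReal.ofReal ‖φ.comp (T t)‖ * ENNReal.ofReal ‖y‖ := by
        refine lintegral_mono fun t => ?_
        rw [← ENNReal.ofReal_mul (norm_nonneg _)]
        exact ENNReal.ofReal_le_ofReal
          ((le_abs_self _).trans ((φ.comp (T t)).le_opNorm y))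
    _ = (∫⁻ t in Ici (0 : ℝ), ENNReal.ofReal ‖φ.comp (T t)‖) * ENNReal.ofReal ‖y‖ :=
        lintegral_mul_const' _ _ ENNReal.ofReal_ne_top
    _ < ⊤ := ENNReal.mul_lt_top hfin ENNReal.ofReal_lt_top

variable [IsOrderedAddMonoid X]

theorem IsPositiveSemigroup.mono (hpos : IsPositiveSemigroup T) {t : ℝ} (ht : 0 ≤ t) {x y : X}
    (h : x ≤ y) : T t x ≤ T t y := by
  have := hpos t ht _ (sub_nonneg.2 h)
  rwa [map_sub, sub_nonneg] at this

/-- If `T (t - s) e ≤ K e` for `s ∈ [a, t]`, then `(t - a) T t e` is controlled by the integral of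
the orbit of `e` over `[a, t]`. -/
theorem IsC0Semigroup.mul_apply_le_integral (hT : IsC0Semigroup T) (hpos : IsPositiveSemigroup T)
    {e : X} {K a t : ℝ} (ha : 0 ≤ a) (hat : a ≤ t)
    (hK : ∀ s ∈ Icc a t, T (t - s) e ≤ K • e) {φ : X →L[ℝ] ℝ} (hφ : IsPositiveFunctional φ) :
    (t - a) * φ (T t e) ≤ K * ∫ s in a..t, φ (T s e) := by
  have hint := hT.intervalIntegrable_functional φ e ha hat
  rw [← smul_eq_mul, ← intervalIntegral.integral_const, ← intervalIntegral.integral_const_mul]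
  refine intervalIntegral.integral_mono_on hat intervalIntegrable_const (hint.const_mul K)
    fun s hs => ?_
  have hs₀ : 0 ≤ s := ha.trans hs.1
  have h := hφ.mono (hpos.mono hs₀ (hK s hs))
  rwa [← hT.add_apply hs₀ (sub_nonneg.2 hs.2), add_sub_cancel, map_smul, map_smul,
    smul_eq_mul] at h

variable [IsOrderedModule ℝ X]

/-- Weak `L¹` stability makes the integrals of the orbit of the order unit uniformly bounded. -/
theorem WeaklyL1StableOnCone.exists_integral_le {e : X} (hX : IsOrderUnitSpace e)
    (hT : IsC0Semigroup T) (hpos : IsPositiveSemigroup T) (hw : WeaklyL1StableOnCone T) :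
    ∃ C : ℝ, 0 ≤ C ∧ ∀ φ : X →L[ℝ] ℝ, IsPositiveFunctional φ →
      ∀ a b : ℝ, 0 ≤ a → a ≤ b → ∫ s in a..b, φ (T s e) ≤ C * φ e := by
  have he := hX.isOrderUnit.1
  have hint : ∀ φ : X →L[ℝ] ℝ, IsPositiveFunctional φ →
      IntegrableOn (fun t => φ (T t e)) (Ici 0) := fun φ hφ =>
    hT.integrableOn_functional_of_lintegral_lt_top hpos hφ he (hw φ hφ e he)
  obtain ⟨C, hC₀, hC⟩ := exists_le_mul_apply_orderUnit hX
    (fun φ => ∫ t in Ici (0 : ℝ), φ (T t e))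
    (fun φ ψ hφ hψ h => setIntegral_mono_on (hint φ hφ) (hint ψ hψ) measurableSet_Ici
      fun t ht => h _ (hpos t ht e he))
    (fun c φ _ _ => by simpa using integral_const_mul c fun t => φ (T t e))
  refine ⟨C, hC₀, fun φ hφ a b ha hab => (le_trans ?_ (hC φ hφ))⟩
  rw [intervalIntegral.integral_of_le hab]
  refine setIntegral_mono_set (hint φ hφ) ?_ (LE.le.eventuallyLE ?_)
  · filter_upwards [ae_restrict_mem measurableSet_Ici] with t ht using hφ _ (hpos t ht e he)
  · exact fun t ht => ha.trans ht.1.le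

theorem IsC0Semigroup.exists_bound_orderUnit_Icc {e : X} (hX : IsOrderUnitSpace e)
    (hT : IsC0Semigroup T) : ∃ K : ℝ, 0 ≤ K ∧ ∀ t ∈ Icc (0 : ℝ) 1, T t e ≤ K • e := by
  obtain ⟨K, hK⟩ := (isCompact_Icc (a := (0 : ℝ)) (b := 1)).exists_bound_of_continuousOn
    ((hT.continuousOn e).mono Icc_subset_Ici_self)
  exact ⟨K, (norm_nonneg _).trans (hK 0 (left_mem_Icc.2 zero_le_one)), fun t ht =>
    (hX.neg_le_and_le _).2.trans (smul_le_smul_of_nonneg_right (hK t ht) hX.isOrderUnit.1)⟩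

theorem WeaklyL1StableOnCone.exponentiallyStable {e : X} (hX : IsOrderUnitSpace e)
    (hT : IsC0Semigroup T) (hpos : IsPositiveSemigroup T) (hw : WeaklyL1StableOnCone T) :
    ExponentiallyStable T := by
  have he := hX.isOrderUnit.1
  obtain ⟨C, hC₀, hC⟩ := hw.exists_integral_le hX hT hpos
  obtain ⟨K, hK₀, hK⟩ := hT.exists_bound_orderUnit_Icc hX
  have hbound : ∀ t, 0 ≤ t → T t e ≤ max K (K * C) • e := by
    intro t ht
    rcases le_total t 1 with h1 | h1
    · exact (hK t ⟨ht, h1⟩).trans (smul_le_smul_of_nonneg_right (le_max_left _ _) he)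
    · refine le_trans ?_ (smul_le_smul_of_nonneg_right (le_max_right K (K * C)) he)
      refine hX.le_of_forall_functional fun φ hφ => ?_
      -- On a window of length one, `t - s` stays in `[0, 1]`, where the local bound `K` applies.
      have h := hT.mul_apply_le_integral hpos (a := t - 1) (t := t) (sub_nonneg.2 h1)
        (by linarith) (fun s hs => hK _ ⟨by linarith [hs.2], by linarith [hs.1]⟩) hφ
      rw [sub_sub_cancel, one_mul] at h
      rw [map_smul, smul_eq_mul, mul_assoc]
      exact h.trans (mul_le_mul_of_nonneg_left (hC φ hφ _ _ (sub_nonneg.2 h1) (by linarith)) hK₀)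
  set L := max K (K * C)
  have hL₀ : 0 ≤ L := hK₀.trans (le_max_left _ _)
  have hdecay : ∀ t, 0 < t → T t e ≤ (L * C / t) • e := by
    intro t ht
    refine hX.le_of_forall_functional fun φ hφ => ?_
    have h := hT.mul_apply_le_integral hpos le_rfl ht.le
      (fun s hs => hbound _ (sub_nonneg.2 hs.2)) hφ
    rw [sub_zero] at h
    have h' := h.trans (mul_le_mul_of_nonneg_left (hC φ hφ 0 t le_rfl ht.le) hL₀)
    rw [map_smul, smul_eq_mul, div_mul_eq_mul_div, le_div_iff₀ ht]
    linarith
  have hLC : 0 ≤ L * C := mul_nonneg hL₀ hC₀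
  -- At this time `L C / t₀ ≤ 1/2`; the `+ 1` guards against `L C = 0`.
  have ht₀ : 0 < 2 * (L * C) + 1 := by positivity
  refine hT.exponentiallyStable_of_norm_le_half
    (fun t ht => hX.opNorm_le (hpos t ht) hL₀ (hbound t ht)) ht₀
    ((hX.opNorm_le (hpos _ ht₀.le) (by positivity) (hdecay _ ht₀)).trans ?_)
  rw [div_le_div_iff₀ ht₀ two_pos]
  linarith

end Stability

end PositiveSemigroup

theorem mainTheorem10 {X : Type*} [NormedAddCommGroup X] [NormedSpace ℝ X]
    [PartialOrder X] [IsOrderedAddMonoid X] [IsOrderedModule ℝ X]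
    (e : X) (hX : PositiveSemigroup.IsOrderUnitSpace e)
    (T : ℝ → X →L[ℝ] X) (hT : PositiveSemigroup.IsC0Semigroup T)
    (hpos : PositiveSemigroup.IsPositiveSemigroup T)
    (z : X) (hz : PositiveSemigroup.IsL1NormDetector T z) :
    List.TFAE [
      ∃ x : (PositiveSemigroup.generator T).domain,
        0 ≤ (x : X) ∧ PositiveSemigroup.generator T x = -z,
      PositiveSemigroup.WeaklyL1StableOnCone T,
      PositiveSemigroup.ExponentiallyStable T,
      ∃ R : X →L[ℝ] X, PositiveSemigroup.IsBoundedInverse (PositiveSemigroup.generator T) R ∧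
        ∀ x : X, 0 ≤ x → 0 ≤ -(R x)] := by
  have := hX.complete
  have := hX.orderClosedTopology
  tfae_have 1 → 2 := by
    rintro ⟨x, hx, hxz⟩
    have h := PositiveSemigroup.hasGeneratorValue_generator T x
    rw [hxz] at h
    exact PositiveSemigroup.weaklyL1StableOnCone_of_isL1NormDetector hT hpos hx hz h
  tfae_have 2 → 3 := fun hw => hw.exponentiallyStable hX hT hpos
  tfae_have 3 → 4 := by
    intro hs
    obtain ⟨Q, hQ⟩ := hT.exists_integral_operator hs
    refine ⟨-Q, hT.isBoundedInverse_neg_integral hs hQ, fun x hx => ?_⟩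
    rw [neg_apply, neg_neg, hQ]
    refine integral_nonneg_of_ae ?_
    filter_upwards [ae_restrict_mem measurableSet_Ioi] with t ht using hpos t (le_of_lt ht) x hx
  tfae_have 4 → 1 := by
    rintro ⟨R, ⟨hR, -⟩, hRpos⟩
    obtain ⟨hdom, hval⟩ := hR (-z)
    exact ⟨⟨R (-z), hdom⟩, by simpa using hRpos z hz.1, hval⟩
  tfae_finish
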